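/- Let $(X,\mathcal B,\mu)$ be a standard Borel space with a $\sigma$-finite measure $\mu$ satisfying $\mu(\{x\})=0$ for all $x\in X$. Let $X^*$ be the set of countable subsets of $X$, with the $\sigma$-algebra $\mathcal B^*$ generated by the sets $\{\omega : |\omega\cap B|=n\}$ ($B\in\mathcal B$, $n\ge 0$), and let $\mu^*$ be the law on $(X^*,\mathcal B^*)$ of the Poisson point process with intensity $\mu$: for pairwise disjoint $A_1,\dots,A_n\in\mathcal B$ the counts $|\omega\cap A_i|$ are independent, and $|\omega\cap A|$ is Poisson distributed with mean $\mu(A)$ for every $A\in\mathcal B$ (almost surely infinite if $\mu(A)=\infty$). Let $T=(T_g)_{g\in G}$ be an action of a group $G$ on $X$ by measurable, $\mu$-preserving transformations, and let $T_*$ be the induced action on $X^*$, $(T_g)_*(\omega)=\{T_g x : x\in\omega\}$. Assume that the product action $T\times T_*$ on $(X\times X^*,\ \mathcal B\otimes\mathcal B^*,\ \mu\times\mu^*)$ is ergodic: every measurable set that is invariant modulo null sets under each $T_g\times (T_g)_*$ is null or has null complement. A (deterministic) thinning is a measurable map $\Psi:X^*\to X^*$ such that for every $B\in\mathcal B$,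 $|\Psi(\omega)\cap B|\le|\omega\cap B|$ for $\mu^*$-almost every $\omega$. It is $T$-equivariant if for every $g\in G$, $\Psi\circ (T_g)_*=(T_g)_*\circ\Psi$ holds $\mu^*$-almost everywhere. Then every $T$-equivariant thinning $\Psi$ is trivial: either $\Psi(\omega)=\emptyset$ for $\mu^*$-almost every $\omega$, or $\Psi(\omega)=\omega$ for $\mu^*$-almost every $\omega$. -/

import Mathlib

open MeasureTheory ProbabilityTheory

/-- The space `X*` of countable subsets of `X`. -/
def CountableConfig (X : Type*) : Type _ := {s : Set X // s.Countable}

namespace CountableConfig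

variable {X : Type*}

/-- The underlying set of points of a configuration. -/
def points (ω : CountableConfig X) : Set X := ω.1

/-- The number `|ω ∩ B|` of points of `ω` in `B`, possibly infinite. -/
noncomputable def count (B : Set X) (ω : CountableConfig X) : ℕ∞ := (ω.points ∩ B).encard

/-- The configuration without points. -/
def empty : CountableConfig X := ⟨∅, Set.countable_empty⟩

/-- The σ-algebra on `X*` generated by the events `|ω ∩ B| = n`, for `B` measurable and `n : ℕ`. -/
instance [MeasurableSpace X] : MeasurableSpace (CountableConfig X) :=
  MeasurableSpace.generateFrom
    {S | ∃ B : Set X, MeasurableSet B ∧ ∃ n : ℕ, S = {ω | count B ω = n}}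

/-- An action `T` on `X` induces the action `T_*` on `X*` given by `T_*(ω) = {T x : x ∈ ω}`. -/
instance {G : Type*} [Group G] [MulAction G X] : MulAction G (CountableConfig X) where
  smul g ω := ⟨(fun x => g • x) '' ω.1, ω.2.image _⟩
  one_smul ω := Subtype.ext (by
    change (fun x => (1 : G) • x) '' ω.1 = ω.1
    simp)
  mul_smul g h ω := Subtype.ext (by
    change (fun x => (g * h) • x) '' ω.1 = (fun x => g • x) '' ((fun x => h • x) '' ω.1)
    simp [Set.image_image, mul_smul])

end CountableConfig

/-- `P` is the law of the Poisson point process with intensity `μ`: the numbers of points in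
pairwise disjoint measurable sets are jointly independent, and the number of points in `A` has the
Poisson distribution with mean `μ A` (and is almost surely infinite if `μ A = ∞`). -/
structure IsPoissonProcess {X : Type*} [MeasurableSpace X] (μ : Measure X)
    (P : Measure (CountableConfig X)) : Prop where
  isProbabilityMeasure : IsProbabilityMeasure P
  indep : ∀ (n : ℕ) (A : Fin n → Set X), (∀ i, MeasurableSet (A i)) →
    Pairwise (fun i j => Disjoint (A i) (A j)) →
    iIndepFun (fun i => CountableConfig.count (A i)) P
  law : ∀ A : Set X, MeasurableSet A → μ A ≠ ⊤ → ∀ k : ℕ,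
    P {ω | CountableConfig.count A ω = k} =
      ENNReal.ofReal (Real.exp (-(μ A).toReal) * (μ A).toReal ^ k / (k.factorial : ℝ))
  law_top : ∀ A : Set X, MeasurableSet A → μ A = ⊤ → ∀ k : ℕ,
    P {ω | CountableConfig.count A ω = k} = 0

/-- A deterministic thinning of the point process with law `P`. -/
structure IsThinning {X : Type*} [MeasurableSpace X] (P : Measure (CountableConfig X))
    (Ψ : CountableConfig X → CountableConfig X) : Prop where
  measurable : Measurable Ψ
  count_le : ∀ B : Set X, MeasurableSet B →
    ∀ᵐ ω ∂P, CountableConfig.count B (Ψ ω) ≤ CountableConfig.count B ω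

/-- `Ψ ∘ T_* = T_* ∘ Ψ` almost surely, for each transformation of the action. -/
def IsEquivariantThinning (G : Type*) {X : Type*} [Group G] [MulAction G X] [MeasurableSpace X]
    (P : Measure (CountableConfig X)) (Ψ : CountableConfig X → CountableConfig X) : Prop :=
  IsThinning P Ψ ∧ ∀ g : G, ∀ᵐ ω ∂P, Ψ (g • ω) = g • Ψ ω

/-- A thinning is trivial if almost surely it deletes every point, or almost surely it deletes
none. -/
def IsTrivialThinning {X : Type*} [MeasurableSpace X]
    (P : Measure (CountableConfig X)) (Ψ : CountableConfig X → CountableConfig X) : Prop :=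
  (∀ᵐ ω ∂P, Ψ ω = CountableConfig.empty) ∨ (∀ᵐ ω ∂P, Ψ ω = ω)

open MeasureTheory ProbabilityTheory

open scoped ENNReal

namespace CountableConfig

/-! ### Counts and the insertion of a point -/

section Points

variable {X : Type*}

/-! Let `S` be the set of pairs (x, ω) such that the thinning of ω ∪ {x} keeps x. Equivariance makes
`S` invariant modulo null sets under the product action, so ergodicity makes it null or conull.
Mecke's formula (`map_adjoin_eq_map_compProd`) says that the pair (x, ω ∪ {x}), with x drawn from μ
and ω from P, is distributed like a Poisson configuration with one of its points marked. Hence what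
holds for almost every added point holds at all points of almost every ω (`ae_forall_mem_points`):
the thinning keeps every point or deletes every point. Mecke's formula comes from the Poisson
recursion (k+1) p(k+1) = c p(k), applied to the independent counts in the cells of a finite
partition (`lintegral_coord_eq_mul_measure_add_single`). Finite partitions generate the σ-algebra
and form a π-system, so the identity extends to all events. -/

@[ext]
theorem ext_points {ω ω' : CountableConfig X} (h : ω.points = ω'.points) : ω = ω' :=
  Subtype.ext h

theorem count_eq_zero {B : Set X} {ω : CountableConfig X} :
    count B ω = 0 ↔ Disjoint ω.points B := by
  rw [count, Set.encard_eq_zero, Set.disjoint_iff_inter_eq_empty]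

theorem count_mono_points {B : Set X} {ω ω' : CountableConfig X} (h : ω.points ⊆ ω'.points) :
    count B ω ≤ count B ω' :=
  Set.encard_le_encard (Set.inter_subset_inter_left _ h)

theorem count_preimage_finset {ι : Type*} (φ : X → ι) (J : Finset ι) (ω : CountableConfig X) :
    count (φ ⁻¹' J) ω = ∑ j ∈ J, count (φ ⁻¹' {j}) ω := by
  classical
  induction J using Finset.induction_on with
  | empty => simp [count]
  | insert j J hj ih =>
    rw [Finset.sum_insert hj, ← ih]
    simp only [count]
    rw [← Set.encard_union_eq]
    · congr 1
      ext x
      simp only [Finset.coe_insert, Set.mem_inter_iff, Set.mem_preimage, Set.mem_insert_iff,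
        Set.mem_union, Set.mem_singleton_iff, Finset.mem_coe]
      tauto
    · rw [Set.disjoint_left]
      rintro x ⟨-, rfl⟩ ⟨-, hx⟩
      exact hj hx

theorem count_smul {G : Type*} [Group G] [MulAction G X] (g : G) (B : Set X)
    (ω : CountableConfig X) : count B (g • ω) = count ((g • ·) ⁻¹' B) ω := by
  change ((fun x => g • x) '' ω.1 ∩ B).encard = (ω.1 ∩ (g • ·) ⁻¹' B).encard
  rw [← Set.image_inter_preimage, (MulAction.injective g).encard_image]

theorem mem_points_smul {G : Type*} [Group G] [MulAction G X] {g : G} {x : X}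
    {ω : CountableConfig X} : g • x ∈ (g • ω).points ↔ x ∈ ω.points :=
  (MulAction.injective g).mem_set_image

/-- The configuration `ω` with the point `x` added. -/
def insertPoint (x : X) (ω : CountableConfig X) : CountableConfig X :=
  ⟨insert x ω.1, ω.2.insert x⟩

theorem points_insertPoint (x : X) (ω : CountableConfig X) :
    (insertPoint x ω).points = insert x ω.points := rfl

theorem smul_insertPoint {G : Type*} [Group G] [MulAction G X] (g : G) (x : X)
    (ω : CountableConfig X) : g • insertPoint x ω = insertPoint (g • x) (g • ω) :=
  Subtype.ext (Set.image_insert_eq)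

theorem count_insertPoint_of_notMem {B : Set X} {x : X} {ω : CountableConfig X} (hB : x ∉ B) :
    count B (insertPoint x ω) = count B ω := by
  simp only [count, points_insertPoint, Set.insert_inter_of_notMem hB]

theorem count_insertPoint_of_mem {B : Set X} {x : X} {ω : CountableConfig X} (hB : x ∈ B)
    (hx : x ∉ ω.points) : count B (insertPoint x ω) = count B ω + 1 := by
  simp only [count, points_insertPoint, Set.insert_inter_of_mem hB]
  exact Set.encard_insert_of_notMem fun h => hx h.1

theorem insertPoint_of_mem {x : X} {ω : CountableConfig X} (hx : x ∈ ω.points) :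
    insertPoint x ω = ω :=
  Subtype.ext (Set.insert_eq_of_mem hx)

end Points

/-! ### Measurability of incidence and of adding a point -/

variable {X : Type*} [MeasurableSpace X]

theorem measurable_count {B : Set X} (hB : MeasurableSet B) : Measurable (count B) := by
  have key : ∀ n : ℕ, MeasurableSet (count B ⁻¹' {(n : ℕ∞)}) := fun n =>
    MeasurableSpace.measurableSet_generateFrom ⟨B, hB, n, rfl⟩
  refine measurable_to_countable' fun n => ?_
  induction n using ENat.recTopCoe with
  | coe n => exact key n
  | top =>
    have : count B ⁻¹' {(⊤ : ℕ∞)} = (⋃ n : ℕ, count B ⁻¹' {(n : ℕ∞)})ᶜ := by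
      ext ω
      simp only [Set.mem_preimage, Set.mem_singleton_iff, Set.mem_compl_iff, Set.mem_iUnion]
      rw [← not_iff_not, not_not, ← Ne, ENat.ne_top_iff_exists]
      simp only [eq_comm]
    rw [this]
    exact (MeasurableSet.iUnion key).compl

theorem measurable_of_count {Y : Type*} [MeasurableSpace Y] {f : Y → CountableConfig X}
    (h : ∀ B, MeasurableSet B → Measurable fun y => count B (f y)) : Measurable f := by
  refine measurable_generateFrom ?_
  rintro _ ⟨B, hB, n, rfl⟩
  exact h B hB (measurableSet_singleton (n : ℕ∞))

instance {G : Type*} [Group G] [MulAction G X] [MeasurableConstSMul G X] :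
    MeasurableConstSMul G (CountableConfig X) where
  measurable_const_smul g := measurable_of_count fun B hB => by
    simp only [count_smul]
    exact measurable_count (measurable_const_smul g hB)

/-- The configurations with finitely many points in each of the sets `spanningSets μ k`. -/
def locallyFinite (μ : Measure X) [SigmaFinite μ] : Set (CountableConfig X) :=
  {ω | ∀ k, count (spanningSets μ k) ω ≠ ⊤}

theorem measurableSet_locallyFinite (μ : Measure X) [SigmaFinite μ] :
    MeasurableSet (locallyFinite μ) := by
  simp only [locallyFinite, Set.ofPred_forall]
  exact MeasurableSet.iInter fun k =>
    measurable_count (measurableSet_spanningSets μ k) (MeasurableSet.of_discrete (s := {⊤}ᶜ))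

theorem locallyFinite_mono {μ : Measure X} [SigmaFinite μ] {ω ω' : CountableConfig X}
    (h : ω.points ⊆ ω'.points) (hω : ω' ∈ locallyFinite μ) : ω ∈ locallyFinite μ :=
  fun k => ne_top_of_le_ne_top (hω k) (count_mono_points h)

/-- A countable family of measurable sets separates points from locally finite configurations. -/
theorem exists_separating_seq [StandardBorelSpace X] (μ : Measure X) [SigmaFinite μ] :
    ∃ W : ℕ → Set X, (∀ n, MeasurableSet (W n)) ∧
      ∀ ω ∈ locallyFinite μ, ∀ x ∉ ω.points, ∃ n, x ∈ W n ∧ count (W n) ω = 0 := by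
  let e := embeddingReal X
  have he := measurableEmbedding_embeddingReal X
  have hb := TopologicalSpace.isBasis_countableBasis ℝ
  obtain ⟨U, hU⟩ := (TopologicalSpace.countable_countableBasis ℝ).exists_eq_range
    (let ⟨V, hV, _⟩ := hb.exists_subset_of_mem_open (Set.mem_univ 0) isOpen_univ; ⟨V, hV⟩)
  -- Basic open sets of ℝ pulled back to X and cut down to one spanning set, where ω has finitely
  -- many points; their image is closed in ℝ, so a basic open set around `e x` avoids it.
  refine ⟨fun n => e ⁻¹' U n.unpair.1 ∩ spanningSets μ n.unpair.2, fun n => ?_, ?_⟩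
  · refine (he.measurable ?_).inter (measurableSet_spanningSets μ _)
    have : U n.unpair.1 ∈ TopologicalSpace.countableBasis ℝ := hU ▸ Set.mem_range_self _
    exact (hb.isOpen this).measurableSet
  · intro ω hω x hx
    obtain ⟨k, hk⟩ : ∃ k, x ∈ spanningSets μ k := by
      have := Set.mem_univ x
      rwa [← iUnion_spanningSets μ, Set.mem_iUnion] at this
    have hfin : (e '' (ω.points ∩ spanningSets μ k)).Finite :=
      (Set.encard_ne_top_iff.1 (hω k)).image e
    have hxe : e x ∈ (e '' (ω.points ∩ spanningSets μ k))ᶜ := by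
      rintro ⟨y, hy, hyx⟩
      exact hx (he.injective hyx ▸ hy.1)
    obtain ⟨V, hV, hxV, hVs⟩ := hb.exists_subset_of_mem_open hxe hfin.isClosed.isOpen_compl
    rw [hU] at hV
    obtain ⟨m, rfl⟩ := hV
    refine ⟨Nat.pair m k, by simpa using ⟨hxV, hk⟩, ?_⟩
    rw [count_eq_zero, Set.disjoint_left]
    simp only [Nat.unpair_pair]
    rintro y hy ⟨hy1, hy2⟩
    exact hVs hy1 ⟨y, ⟨hy, hy2⟩, rfl⟩

/-- The incidence relation between points and locally finite configurations. -/
def incidence (μ : Measure X) [SigmaFinite μ] : Set (X × CountableConfig X) :=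
  {p | p.1 ∈ p.2.points ∧ p.2 ∈ locallyFinite μ}

/-- Among locally finite configurations, non-incidence is a countable union of rectangles, by the
separating family. -/
theorem measurableSet_incidence [StandardBorelSpace X] (μ : Measure X) [SigmaFinite μ] :
    MeasurableSet (incidence μ) := by
  obtain ⟨W, hW, hsep⟩ := exists_separating_seq μ
  have : incidence μ =
      (⋃ n, W n ×ˢ (count (W n) ⁻¹' {0}))ᶜ ∩ Prod.snd ⁻¹' locallyFinite μ := by
    ext ⟨x, ω⟩
    simp only [incidence, Set.mem_ofPred_eq, Set.mem_inter_iff, Set.mem_compl_iff, Set.mem_iUnion,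
      Set.mem_prod, Set.mem_preimage, Set.mem_singleton_iff, and_congr_left_iff]
    intro hω
    constructor
    · rintro hx ⟨n, hn, h0⟩
      exact Set.disjoint_left.1 (count_eq_zero.1 h0) hx hn
    · intro h
      by_contra hx
      exact h (hsep ω hω x hx)
  rw [this]
  exact (MeasurableSet.iUnion fun n => (hW n).prod
    (measurable_count (hW n) (measurableSet_singleton 0))).compl.inter
    (measurable_snd (measurableSet_locallyFinite μ))

open Classical in
/-- Addition of a point to a locally finite configuration; other configurations are unchanged. -/
noncomputable def adjoin (μ : Measure X) [SigmaFinite μ] (p : X × CountableConfig X) :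
    CountableConfig X :=
  if p.2 ∈ locallyFinite μ then insertPoint p.1 p.2 else p.2

theorem adjoin_of_mem {μ : Measure X} [SigmaFinite μ] {p : X × CountableConfig X}
    (h : p.2 ∈ locallyFinite μ) : adjoin μ p = insertPoint p.1 p.2 := if_pos h

theorem measurable_adjoin [StandardBorelSpace X] (μ : Measure X) [SigmaFinite μ] :
    Measurable (adjoin μ) := by
  classical
  refine measurable_of_count fun B hB => ?_
  have hS : MeasurableSet (Prod.fst ⁻¹' B ∩ (Prod.snd ⁻¹' locallyFinite μ \ incidence μ) :
      Set (X × CountableConfig X)) :=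
    (measurable_fst hB).inter
      ((measurable_snd (measurableSet_locallyFinite μ)).diff (measurableSet_incidence μ))
  have h1 : Measurable fun p : X × CountableConfig X => count B p.2 :=
    (measurable_count hB).comp measurable_snd
  -- The count in `B` rises by one exactly when the added point lies in `B` and is new; newness is
  -- measurable because incidence is.
  have key : (fun p => count B (adjoin μ p)) = fun p : X × CountableConfig X =>
      if p ∈ Prod.fst ⁻¹' B ∩ (Prod.snd ⁻¹' locallyFinite μ \ incidence μ) then count B p.2 + 1
      else count B p.2 := by
    funext ⟨x, ω⟩
    simp only [Set.mem_inter_iff, Set.mem_preimage, Set.mem_sdiff, incidence, Set.mem_ofPred_eq,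
      not_and]
    by_cases hω : ω ∈ locallyFinite μ
    · rw [adjoin_of_mem hω]
      by_cases hxB : x ∈ B
      · by_cases hx : x ∈ ω.points
        · simp [hω, hx, insertPoint_of_mem hx]
        · simp [hω, hx, hxB, count_insertPoint_of_mem hxB hx]
      · simp [hxB, count_insertPoint_of_notMem hxB]
    · simp [adjoin, hω]
  rw [key]
  exact Measurable.ite hS ((Measurable.of_discrete (f := fun n : ℕ∞ => n + 1)).comp h1) h1

end CountableConfig

/-! ### Size-biasing of independent counts -/

/-- For independent `ℕ∞`-valued variables, a recursion for the law of one coordinate (as satisfied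
by the Poisson law with mean `c`) yields a size-biasing identity for the whole vector. -/
theorem lintegral_coord_eq_mul_measure_add_single {Ω ι : Type*} [MeasurableSpace Ω] [Fintype ι]
    [DecidableEq ι] {P : Measure Ω} {N : ι → Ω → ℕ∞} (hN : ∀ i, Measurable (N i))
    (hind : iIndepFun N P) {j : ι} {c : ℝ≥0∞} (htop : P {ω | N j ω = ⊤} = 0)
    (hrec : ∀ k : ℕ, ((k + 1 : ℕ) : ℝ≥0∞) * P {ω | N j ω = (k + 1 : ℕ)} = c * P {ω | N j ω = k})
    (D : Set (ι → ℕ∞)) :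
    ∫⁻ ω in {ω | (fun i => N i ω) ∈ D}, (N j ω : ℝ≥0∞) ∂P =
      c * P {ω | (fun i => N i ω) + Pi.single j 1 ∈ D} := by
  have hprod : ∀ n : ι → ℕ∞, P {ω | (fun i => N i ω) = n} = ∏ i, P {ω | N i ω = n i} := by
    intro n
    have := hind.measure_inter_preimage_eq_mul Finset.univ (sets := fun i => {n i})
      fun i _ => measurableSet_singleton _
    refine Eq.trans (congrArg P ?_) this
    ext ω
    simp [funext_iff]
  -- Since `ι → ℕ∞` is countable, the identity need only be checked on single vectors and summed
  -- over `D`.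
  have point : ∀ n : ι → ℕ∞, (n j : ℝ≥0∞) * P {ω | (fun i => N i ω) = n} =
      c * P {ω | (fun i => N i ω) + Pi.single j 1 = n} := by
    intro n
    cases hn : n j using ENat.recTopCoe with
    | top =>
      have h1 : P {ω | (fun i => N i ω) = n} = 0 :=
        measure_mono_null (fun ω (hω : _ = _) => by simp [← hn, ← hω]) htop
      have h2 : P {ω | (fun i => N i ω) + Pi.single j 1 = n} = 0 :=
        measure_mono_null (fun ω (hω : _ = _) => by
          have := congrFun hω j
          simpa [hn] using this) htop
      rw [h1, h2, mul_zero, mul_zero]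
    | coe m =>
      cases m with
      | zero =>
        have : {ω | (fun i => N i ω) + Pi.single j 1 = n} = ∅ := by
          refine Set.eq_empty_of_forall_notMem fun ω (hω : _ = _) => ?_
          have := congrFun hω j
          simp [hn] at this
        rw [this]
        simp
      -- Adding one at `j` gives `n` iff the counts equal `n` with coordinate `j` lowered to `k`. By
      -- independence only the factor at `j` changes, as in `hrec`.
      | succ k =>
        have : {ω | (fun i => N i ω) + Pi.single j 1 = n} =
            {ω | (fun i => N i ω) = Function.update n j k} := by
          ext ω
          simp only [Set.mem_ofPred_eq, funext_iff, Pi.add_apply]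
          refine forall_congr' fun i => ?_
          by_cases hi : i = j
          · subst hi
            rw [hn]
            simp only [Pi.single_eq_same, Function.update_self, Nat.cast_add, Nat.cast_one]
            exact (ENat.add_left_injective_of_ne_top ENat.one_ne_top).eq_iff
          · simp [hi]
        rw [this, hprod, hprod, ← Finset.mul_prod_erase _ _ (Finset.mem_univ j),
          ← Finset.mul_prod_erase _ (fun i => P {ω | N i ω = Function.update n j k i})
            (Finset.mem_univ j), ← mul_assoc, ← mul_assoc, hn, Function.update_self]
        have e : ∏ i ∈ Finset.univ.erase j, P {ω | N i ω = Function.update n j k i} =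
            ∏ i ∈ Finset.univ.erase j, P {ω | N i ω = n i} :=
          Finset.prod_congr rfl fun i hi => by
            rw [Function.update_of_ne (Finset.ne_of_mem_erase hi)]
        rw [e, ← hrec k]
        simp
  have hV : Measurable fun ω i => N i ω := measurable_pi_lambda _ hN
  have hV' : Measurable fun ω => (fun i => N i ω) + Pi.single j 1 :=
    measurable_pi_lambda _ fun i =>
      (Measurable.of_discrete (f := fun m : ℕ∞ => m + (Pi.single j 1 : ι → ℕ∞) i)).comp (hN i)
  have hD : MeasurableSet D := D.to_countable.measurableSet
  have hf : Measurable fun v : ι → ℕ∞ => (v j : ℝ≥0∞) := Measurable.of_discrete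
  have l : ∫⁻ ω in {ω | (fun i => N i ω) ∈ D}, (N j ω : ℝ≥0∞) ∂P =
      ∑' n, D.indicator (fun v => (v j : ℝ≥0∞)) n * P {ω | (fun i => N i ω) = n} := by
    have := setLIntegral_map (μ := P) hD hf hV
    rw [← lintegral_indicator hD, lintegral_countable'] at this
    refine Eq.trans this.symm (tsum_congr fun n => ?_)
    rw [Measure.map_apply hV (measurableSet_singleton n)]
    rfl
  have r : P {ω | (fun i => N i ω) + Pi.single j 1 ∈ D} =
      ∑' n, D.indicator 1 n * P {ω | (fun i => N i ω) + Pi.single j 1 = n} := by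
    have := Measure.map_apply (μ := P) hV' hD
    rw [← lintegral_indicator_one hD, lintegral_countable'] at this
    refine Eq.trans this.symm (tsum_congr fun n => ?_)
    rw [Measure.map_apply hV' (measurableSet_singleton n)]
    rfl
  rw [l, r, ← ENNReal.tsum_mul_left]
  refine tsum_congr fun n => ?_
  by_cases h : n ∈ D
  · simp [h, point n]
  · simp [h]

/-! ### First consequences of the Poisson law -/

namespace IsPoissonProcess

open CountableConfig

variable {X : Type*} [MeasurableSpace X] {μ : Measure X} {P : Measure (CountableConfig X)}

/-- The Poisson weights sum to one, leaving no mass at infinity. -/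
theorem measure_count_eq_top (hP : IsPoissonProcess μ P) {A : Set X} (hA : MeasurableSet A)
    (hμ : μ A ≠ ⊤) : P {ω | count A ω = ⊤} = 0 := by
  have := hP.isProbabilityMeasure
  have hm : ∀ n, MeasurableSet {ω | count A ω = n} := fun n =>
    measurable_count hA (measurableSet_singleton n)
  have h1 : P (⋃ k : ℕ, {ω | count A ω = k}) = 1 := by
    rw [measure_iUnion (f := fun k : ℕ => {ω | count A ω = k})
      (fun i j hij => Set.disjoint_left.2 fun ω (h : _ = _) (h' : _ = _) =>
        hij (by exact_mod_cast h.symm.trans h')) fun k => hm k]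
    simp only [hP.law A hA hμ]
    have h := hasSum_one_poissonMeasure (μ A).toNNReal
    change ∑' k : ℕ, ENNReal.ofReal (Real.exp (-((μ A).toNNReal : ℝ)) *
      ((μ A).toNNReal : ℝ) ^ k / (k.factorial : ℝ)) = 1
    rw [← ENNReal.ofReal_tsum_of_nonneg (fun k => by positivity) h.summable, h.tsum_eq,
      ENNReal.ofReal_one]
  have h2 := (prob_compl_eq_zero_iff (MeasurableSet.iUnion fun k : ℕ => hm k)).2 h1
  refine measure_mono_null (fun ω (hω : _ = _) => ?_) h2
  simp [hω]

theorem succ_mul_measure_count (hP : IsPoissonProcess μ P) {A : Set X} (hA : MeasurableSet A)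
    (hμ : μ A ≠ ⊤) (k : ℕ) :
    ((k + 1 : ℕ) : ℝ≥0∞) * P {ω | count A ω = (k + 1 : ℕ)} = μ A * P {ω | count A ω = k} := by
  rw [hP.law A hA hμ, hP.law A hA hμ, ← ENNReal.ofReal_natCast]
  nth_rw 3 [← ENNReal.ofReal_toReal hμ]
  rw [← ENNReal.ofReal_mul (by positivity), ← ENNReal.ofReal_mul (by positivity)]
  congr 1
  rw [Nat.factorial_succ]
  push_cast
  field_simp
  ring

theorem ae_mem_locallyFinite [SigmaFinite μ] (hP : IsPoissonProcess μ P) :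
    ∀ᵐ ω ∂P, ω ∈ locallyFinite μ :=
  ae_all_iff.2 fun k => by
    rw [ae_iff]
    simpa using hP.measure_count_eq_top (measurableSet_spanningSets μ k)
      (measure_spanningSets_lt_top μ k).ne

theorem ae_notMem_points [StandardBorelSpace X] [NullSingletonClass μ]
    (hP : IsPoissonProcess μ P) (x : X) : ∀ᵐ ω ∂P, x ∉ ω.points := by
  have := hP.isProbabilityMeasure
  have h := hP.law {x} (measurableSet_singleton x) (by simp) 0
  simp only [measure_singleton, ENNReal.toReal_zero, neg_zero, Real.exp_zero, pow_zero, mul_one,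
    Nat.factorial_zero, Nat.cast_one, div_one, ENNReal.ofReal_one, Nat.cast_zero] at h
  have h' := (prob_compl_eq_zero_iff
    (measurable_count (measurableSet_singleton x) (measurableSet_singleton 0))).2 h
  refine measure_mono_null (t := {ω | count {x} ω = 0}ᶜ) (fun ω hω h0 => ?_) h'
  exact Set.disjoint_left.1 (count_eq_zero.1 h0) (not_not.1 hω) rfl

theorem iIndepFun_count {ι : Type*} [Fintype ι] (hP : IsPoissonProcess μ P) {A : ι → Set X}
    (hA : ∀ i, MeasurableSet (A i)) (hd : Pairwise fun i j => Disjoint (A i) (A j)) :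
    iIndepFun (fun i => count (A i)) P := by
  let e := Fintype.equivFin ι
  have h := hP.indep _ (fun i => A (e.symm i)) (fun i => hA _)
    fun i j hij => hd (e.symm.injective.ne hij)
  have h' := h.precomp e.injective
  simpa using h'

end IsPoissonProcess

/-! ### Events determined by finite partitions -/

namespace CountableConfig

variable {X : Type*}

/-- Coarse cells are unions of fine ones and their counts add up, so an event of a coarse partition
is also one of any refinement. -/
theorem setOf_counts_comp {ι κ : Type*} [Fintype κ] [DecidableEq ι] (ψ : X → κ) (h : κ → ι)
    (D : Set (ι → ℕ∞)) :
    {ω : CountableConfig X | (fun i => count ((h ∘ ψ) ⁻¹' {i}) ω) ∈ D} =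
      {ω | (fun k => count (ψ ⁻¹' {k}) ω) ∈
        (fun (v : κ → ℕ∞) i => ∑ k with h k = i, v k) ⁻¹' D} := by
  ext ω
  have : (fun i => count ((h ∘ ψ) ⁻¹' {i}) ω) =
      fun i => ∑ k with h k = i, count (ψ ⁻¹' {k}) ω := by
    funext i
    rw [← count_preimage_finset]
    congr 1
    ext x
    simp
  simp only [Set.mem_ofPred_eq, Set.mem_preimage, this]

variable [MeasurableSpace X]

theorem measurable_toENNReal_count {B : Set X} (hB : MeasurableSet B) :
    Measurable fun ω => (count B ω : ℝ≥0∞) :=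
  (Measurable.of_discrete (f := ENat.toENNReal)).comp (measurable_count hB)

variable (X) in
/-- Events that depend only on the numbers of points in the cells of a finite measurable
partition. -/
def countCylinders : Set (Set (CountableConfig X)) :=
  {E | ∃ (m : ℕ) (φ : X → Fin m), (∀ i, MeasurableSet (φ ⁻¹' {i})) ∧
    ∃ D : Set (Fin m → ℕ∞), E = {ω | (fun i => count (φ ⁻¹' {i}) ω) ∈ D}}

theorem mem_countCylinders {κ : Type*} [Fintype κ] {ψ : X → κ}
    (hψ : ∀ k, MeasurableSet (ψ ⁻¹' {k})) (D : Set (κ → ℕ∞)) :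
    {ω : CountableConfig X | (fun k => count (ψ ⁻¹' {k}) ω) ∈ D} ∈ countCylinders X := by
  let e := Fintype.equivFin κ
  have he : ∀ i, (e ∘ ψ) ⁻¹' {i} = ψ ⁻¹' {e.symm i} := fun i => by
    ext x
    simp [Equiv.eq_symm_apply]
  refine ⟨_, e ∘ ψ, fun i => by rw [he]; exact hψ _,
    (fun v k => v (e k)) ⁻¹' D, ?_⟩
  simp [he]

theorem measurableSet_of_counts {κ : Type*} [Finite κ] {ψ : X → κ}
    (hψ : ∀ k, MeasurableSet (ψ ⁻¹' {k})) (D : Set (κ → ℕ∞)) :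
    MeasurableSet {ω : CountableConfig X | (fun k => count (ψ ⁻¹' {k}) ω) ∈ D} :=
  measurable_pi_lambda _ (fun k => measurable_count (hψ k)) D.to_countable.measurableSet

/-- Two partitions have the common refinement x ↦ (φ x, φ' x). -/
theorem isPiSystem_countCylinders : IsPiSystem (countCylinders X) := by
  rintro _ ⟨m, φ, hφ, D, rfl⟩ _ ⟨m', φ', hφ', D', rfl⟩ -
  have h1 := setOf_counts_comp (fun x => (φ x, φ' x)) Prod.fst D
  have h2 := setOf_counts_comp (fun x => (φ x, φ' x)) Prod.snd D'
  have hψ : ∀ k : Fin m × Fin m', MeasurableSet ((fun x => (φ x, φ' x)) ⁻¹' {k}) := fun k => by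
    convert (hφ k.1).inter (hφ' k.2) using 1
    ext x
    simp [Prod.ext_iff]
  change {ω : CountableConfig X | (fun i => count (φ ⁻¹' {i}) ω) ∈ D} = _ at h1
  change {ω : CountableConfig X | (fun i => count (φ' ⁻¹' {i}) ω) ∈ D'} = _ at h2
  rw [h1, h2]
  exact mem_countCylinders hψ (_ ∩ _)

theorem generateFrom_countCylinders :
    (inferInstance : MeasurableSpace (CountableConfig X)) =
      MeasurableSpace.generateFrom (countCylinders X) := by
  classical
  refine le_antisymm (MeasurableSpace.generateFrom_le ?_) (MeasurableSpace.generateFrom_le ?_)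
  · rintro _ ⟨B, hB, n, rfl⟩
    refine MeasurableSpace.measurableSet_generateFrom ?_
    have ht : (fun x => decide (x ∈ B)) ⁻¹' {true} = B := by ext x; simp
    have hf : (fun x => decide (x ∈ B)) ⁻¹' {false} = Bᶜ := by ext x; simp
    have := mem_countCylinders (ψ := fun x => decide (x ∈ B))
      (Bool.rec (by rw [hf]; exact hB.compl) (by rw [ht]; exact hB)) {v | v true = n}
    simpa only [Set.mem_ofPred_eq, ht] using this
  · rintro _ ⟨m, φ, hφ, D, rfl⟩
    exact measurableSet_of_counts hφ D

end CountableConfig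

/-! ### Mecke's formula for events of the configuration -/

namespace IsPoissonProcess

open CountableConfig

variable {X : Type*} [MeasurableSpace X] {μ : Measure X} {P : Measure (CountableConfig X)}

theorem ae_adjoin_eq [SigmaFinite μ] (hP : IsPoissonProcess μ P) (x : X) :
    ∀ᵐ ω ∂P, adjoin μ (x, ω) = insertPoint x ω := by
  filter_upwards [hP.ae_mem_locallyFinite] with ω hω using adjoin_of_mem hω

/-- The case of Mecke's formula where the set is a union of cells. Almost surely x is not in ω, so
adding it raises the count of the cell `ψ x` by one; integrating over x in cell `j` gives the factor
`μ (ψ ⁻¹' {j})` of the size-biasing identity. -/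
theorem lintegral_count_of_counts [StandardBorelSpace X] [SigmaFinite μ] [NullSingletonClass μ]
    (hP : IsPoissonProcess μ P) {κ : Type*} [Fintype κ] {ψ : X → κ}
    (hψ : ∀ k, MeasurableSet (ψ ⁻¹' {k})) (J : Finset κ) (hJ : μ (ψ ⁻¹' J) ≠ ⊤)
    (D : Set (κ → ℕ∞)) :
    ∫⁻ ω in {ω | (fun k => count (ψ ⁻¹' {k}) ω) ∈ D}, (count (ψ ⁻¹' J) ω : ℝ≥0∞) ∂P =
      ((μ.restrict (ψ ⁻¹' J)).prod P).map (adjoin μ)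
        {ω | (fun k => count (ψ ⁻¹' {k}) ω) ∈ D} := by
  classical
  have := hP.isProbabilityMeasure
  have hE := measurableSet_of_counts hψ D
  have hdisj : Pairwise fun i j => Disjoint (ψ ⁻¹' {i}) (ψ ⁻¹' {j}) := fun i j hij =>
    Disjoint.preimage ψ (by simpa using hij)
  have hmeas : ∀ j ∈ J, μ (ψ ⁻¹' {j}) ≠ ⊤ := fun j hj =>
    ne_top_of_le_ne_top hJ (measure_mono (Set.preimage_mono (by simpa using hj)))
  have hx : ∀ x, P {ω | (fun k => count (ψ ⁻¹' {k}) (adjoin μ (x, ω))) ∈ D} =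
      P {ω | (fun k => count (ψ ⁻¹' {k}) ω) + Pi.single (ψ x) 1 ∈ D} := by
    intro x
    refine measure_congr ?_
    filter_upwards [hP.ae_adjoin_eq x, hP.ae_notMem_points x] with ω h1 h2
    refine congrArg (· ∈ D) ?_
    funext k
    rw [h1]
    by_cases hk : k = ψ x
    · subst hk
      simpa using count_insertPoint_of_mem (B := ψ ⁻¹' {ψ x}) rfl h2
    · rw [count_insertPoint_of_notMem (B := ψ ⁻¹' {k}) fun h => hk (Eq.symm h)]
      simp [hk]
  have hU : ψ ⁻¹' (J : Set κ) = ⋃ j ∈ J, ψ ⁻¹' {j} := by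
    ext x
    simp
  rw [Measure.map_apply (measurable_adjoin μ) hE,
    Measure.prod_apply (measurable_adjoin μ hE)]
  change _ = ∫⁻ x in ψ ⁻¹' J, P {ω | (fun k => count (ψ ⁻¹' {k}) (adjoin μ (x, ω))) ∈ D} ∂μ
  simp only [hx]
  have hr : ∫⁻ x in ψ ⁻¹' J, P {ω | (fun k => count (ψ ⁻¹' {k}) ω) + Pi.single (ψ x) 1 ∈ D} ∂μ =
      ∑ j ∈ J, μ (ψ ⁻¹' {j}) * P {ω | (fun k => count (ψ ⁻¹' {k}) ω) + Pi.single j 1 ∈ D} := by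
    rw [hU, lintegral_biUnion_finset (fun i _ j _ hij => hdisj hij) fun j _ => hψ j]
    refine Finset.sum_congr rfl fun j _ => ?_
    rw [setLIntegral_congr_fun (hψ j) (g := fun _ =>
      P {ω | (fun k => count (ψ ⁻¹' {k}) ω) + Pi.single j 1 ∈ D})
      fun x (hxj : ψ x = j) => by simp only [hxj], setLIntegral_const, mul_comm]
  rw [hr]
  have hc : ∀ ω : CountableConfig X, (count (ψ ⁻¹' J) ω : ℝ≥0∞) =
      ∑ j ∈ J, (count (ψ ⁻¹' {j}) ω : ℝ≥0∞) := fun ω => by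
    rw [count_preimage_finset]
    exact map_sum ENat.toENNRealRingHom _ _
  simp only [hc]
  rw [lintegral_finsetSum _ fun j _ => measurable_toENNReal_count (hψ j)]
  refine Finset.sum_congr rfl fun j hj => ?_
  exact lintegral_coord_eq_mul_measure_add_single (fun k => measurable_count (hψ k))
    (hP.iIndepFun_count hψ hdisj) (hP.measure_count_eq_top (hψ j) (hmeas j hj))
    (hP.succ_mul_measure_count (hψ j) (hmeas j hj)) D

/-- Mecke's formula for functions of the configuration alone. -/
theorem map_adjoin_eq_withDensity [StandardBorelSpace X] [SigmaFinite μ] [NullSingletonClass μ]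
    (hP : IsPoissonProcess μ P) {B : Set X} (hB : MeasurableSet B) (hμ : μ B ≠ ⊤) :
    ((μ.restrict B).prod P).map (adjoin μ) = P.withDensity fun ω => (count B ω : ℝ≥0∞) := by
  classical
  have := hP.isProbabilityMeasure
  have : IsFiniteMeasure (μ.restrict B) := ⟨by simpa using hμ.lt_top⟩
  have key : ∀ (m : ℕ) (φ : X → Fin m), (∀ i, MeasurableSet (φ ⁻¹' {i})) →
      ∀ D : Set (Fin m → ℕ∞),
      ((μ.restrict B).prod P).map (adjoin μ) {ω | (fun i => count (φ ⁻¹' {i}) ω) ∈ D} =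
        P.withDensity (fun ω => (count B ω : ℝ≥0∞))
          {ω | (fun i => count (φ ⁻¹' {i}) ω) ∈ D} := by
    intro m φ hφ D
    rw [withDensity_apply _ (measurableSet_of_counts hφ D)]
    -- Refine the partition by `B`, so that `B` is a union of cells.
    let ψ : X → Fin m × Bool := fun x => (φ x, decide (x ∈ B))
    have hψ : ∀ k, MeasurableSet (ψ ⁻¹' {k}) := by
      rintro ⟨i, b⟩
      have : ψ ⁻¹' {(i, b)} = φ ⁻¹' {i} ∩ (if b then B else Bᶜ) := by
        ext x
        cases b <;> simp [ψ]
      rw [this]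
      refine (hφ i).inter ?_
      cases b
      · exact hB.compl
      · exact hB
    have hJ : ψ ⁻¹' ((Finset.univ.filter fun k : Fin m × Bool => k.2 = true : Finset _) :
        Set (Fin m × Bool)) = B := by
      ext x
      simp [ψ]
    have h1 := setOf_counts_comp ψ Prod.fst D
    change {ω : CountableConfig X | (fun i => count (φ ⁻¹' {i}) ω) ∈ D} = _ at h1
    have h2 := hP.lintegral_count_of_counts hψ (Finset.univ.filter fun k => k.2 = true)
      (by rwa [hJ]) ((fun (v : Fin m × Bool → ℕ∞) i => ∑ k with k.1 = i, v k) ⁻¹' D)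
    rw [hJ] at h2
    rw [h1, h2]
  refine ext_of_generate_finite (countCylinders X) generateFrom_countCylinders
    isPiSystem_countCylinders ?_ ?_
  · rintro _ ⟨m, φ, hφ, D, rfl⟩
    exact key m φ hφ D
  -- Equality of total masses: the one-cell partition.
  · simpa using key 1 (fun _ => 0) (fun i => by simp [Subsingleton.elim i 0]) Set.univ

end IsPoissonProcess

/-! ### The kernel of points of a configuration -/

namespace CountableConfig

variable {X : Type*} [MeasurableSpace X]

theorem count_restrict_points_apply [MeasurableSingletonClass X] (ω : CountableConfig X)
    (B : Set X) {C : Set X} (hC : MeasurableSet C) :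
    (Measure.count : Measure X).restrict (ω.points ∩ B) C = (count (B ∩ C) ω : ℝ≥0∞) := by
  have h : (C ∩ (ω.points ∩ B)).Countable := ω.2.mono fun x hx => hx.2.1
  rw [Measure.restrict_apply hC, Measure.count_apply h.measurableSet, count]
  congr 2
  ext x
  simp only [Set.mem_inter_iff]
  tauto

open Classical in
/-- Counting measure on the points in `B` of configurations with exactly `n` points in `B`. -/
noncomputable def levelPointKernel [MeasurableSingletonClass X] {B : Set X}
    (hB : MeasurableSet B) (n : ℕ) : Kernel (CountableConfig X) X where
  toFun ω := if count B ω = n then Measure.count.restrict (ω.points ∩ B) else 0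
  measurable' := by
    refine Measure.measurable_of_measurable_coe _ fun C hC => ?_
    have : (fun ω : CountableConfig X => (if count B ω = n then
        (Measure.count : Measure X).restrict (ω.points ∩ B) else 0) C) =
        fun ω => if count B ω = n then (count (B ∩ C) ω : ℝ≥0∞) else 0 := by
      funext ω
      split_ifs
      · exact count_restrict_points_apply ω B hC
      · rfl
    rw [this]
    exact Measurable.ite (measurable_count hB (measurableSet_singleton (n : ℕ∞)))
      (measurable_toENNReal_count (hB.inter hC)) measurable_const

theorem levelPointKernel_apply [MeasurableSingletonClass X] {B : Set X}
    (hB : MeasurableSet B) {n m : ℕ} {ω : CountableConfig X} (hω : count B ω = m) :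
    levelPointKernel hB n ω =
      if n = m then Measure.count.restrict (ω.points ∩ B) else 0 := by
  change (if count B ω = n then _ else _) = _
  simp [hω, eq_comm]

/-- The total mass is at most `n`. Splitting by the number of points thus makes the summed kernel
s-finite, though its mass is unbounded in ω. -/
instance [MeasurableSingletonClass X] {B : Set X} (hB : MeasurableSet B) (n : ℕ) :
    IsFiniteKernel (levelPointKernel hB n) where
  exists_univ_le := by
    refine ⟨n, by simp, fun ω => ?_⟩
    change (if count B ω = n then (Measure.count : Measure X).restrict (ω.points ∩ B) else 0)
      Set.univ ≤ _
    split_ifs with h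
    · rw [count_restrict_points_apply ω B .univ, Set.inter_univ, h]
      simp
    · simp

/-- Counting measure on the points in `B` of a configuration with finitely many points in `B`. -/
noncomputable def pointKernel [MeasurableSingletonClass X] {B : Set X}
    (hB : MeasurableSet B) : Kernel (CountableConfig X) X :=
  Kernel.sum (levelPointKernel hB)

instance [MeasurableSingletonClass X] {B : Set X} (hB : MeasurableSet B) :
    IsSFiniteKernel (pointKernel hB) :=
  inferInstanceAs (IsSFiniteKernel (Kernel.sum (levelPointKernel hB)))

theorem pointKernel_apply [MeasurableSingletonClass X] {B : Set X} (hB : MeasurableSet B)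
    {ω : CountableConfig X} (hω : count B ω ≠ ⊤) :
    pointKernel hB ω = Measure.count.restrict (ω.points ∩ B) := by
  obtain ⟨m, hm⟩ := ENat.ne_top_iff_exists.1 hω
  ext C hC
  rw [pointKernel, Kernel.sum_apply' _ _ hC, tsum_eq_single m fun n hn => by
    simp [levelPointKernel_apply hB hm.symm, hn]]
  simp [levelPointKernel_apply hB hm.symm]

end CountableConfig

/-! ### Mecke's formula on X × X* and triviality of thinnings -/

namespace IsPoissonProcess

open CountableConfig

variable {X : Type*} [MeasurableSpace X] [StandardBorelSpace X] {μ : Measure X} [SigmaFinite μ]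
  {P : Measure (CountableConfig X)}

/-- A thinning almost surely keeps only points of the configuration. -/
theorem ae_thinning_subset (hP : IsPoissonProcess μ P)
    {Ψ : CountableConfig X → CountableConfig X} (hΨ : IsThinning P Ψ) :
    ∀ᵐ ω ∂P, (Ψ ω).points ⊆ ω.points := by
  obtain ⟨W, hW, hsep⟩ := exists_separating_seq μ
  filter_upwards [ae_all_iff.2 fun n => hΨ.count_le (W n) (hW n), hP.ae_mem_locallyFinite]
    with ω hle hω x hx
  by_contra hxω
  obtain ⟨n, hn, h0⟩ := hsep ω hω x hxω
  have h := hle n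
  rw [h0, nonpos_iff_eq_zero] at h
  exact Set.disjoint_left.1 (count_eq_zero.1 h) hx hn

variable [NullSingletonClass μ]

/-- Mecke's formula, as an identity between measures on `X × X*`. -/
theorem map_adjoin_eq_map_compProd (hP : IsPoissonProcess μ P) {B : Set X}
    (hB : MeasurableSet B) (hμ : μ B ≠ ⊤) :
    ((μ.restrict B).prod P).map (fun p => (p.1, adjoin μ p)) =
      (P ⊗ₘ pointKernel hB).map Prod.swap := by
  have := hP.isProbabilityMeasure
  have : IsFiniteMeasure (μ.restrict B) := ⟨by simpa using hμ.lt_top⟩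
  -- On a rectangle `C ×ˢ E` the claim is the formula for the configuration alone, with `C ∩ B` in
  -- place of `B`.
  refine Measure.ext_prod fun {C E} hC hE => ?_
  have hCB : μ (C ∩ B) ≠ ⊤ := ne_top_of_le_ne_top hμ (measure_mono Set.inter_subset_right)
  rw [Measure.map_apply (measurable_fst.prodMk (measurable_adjoin μ)) (hC.prod hE),
    Measure.map_apply measurable_swap (hC.prod hE), Set.preimage_swap_prod,
    Measure.compProd_apply_prod hE hC]
  have h := congrArg (fun ν => ν E) (hP.map_adjoin_eq_withDensity (hC.inter hB) hCB)
  simp only [withDensity_apply _ hE, Measure.map_apply (measurable_adjoin μ) hE] at h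
  calc _ = ((μ.restrict (C ∩ B)).prod P) (adjoin μ ⁻¹' E) := by
        rw [← Measure.restrict_restrict hC, Measure.restrict_prod_eq_prod_univ (μ := μ.restrict B) C,
          Measure.restrict_apply (measurable_adjoin μ hE)]
        congr 1
        ext p
        simp [and_comm]
    _ = _ := h
    _ = _ := by
        refine lintegral_congr_ae (ae_restrict_of_ae ?_)
        have htop := hP.measure_count_eq_top hB hμ
        filter_upwards [measure_eq_zero_iff_ae_notMem.1 htop] with ω hω
        rw [pointKernel_apply hB hω, count_restrict_points_apply ω B hC, Set.inter_comm]

/-- With x restricted to a set of finite measure, the law of ω ∪ {x} has a density with respect to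
P. Almost sure properties of ω therefore pass to ω ∪ {x}. -/
theorem quasiMeasurePreserving_adjoin (hP : IsPoissonProcess μ P) :
    Measure.QuasiMeasurePreserving (adjoin μ) (μ.prod P) P := by
  have := hP.isProbabilityMeasure
  refine ⟨measurable_adjoin μ, Measure.AbsolutelyContinuous.mk fun N hN h0 => ?_⟩
  rw [Measure.map_apply (measurable_adjoin μ) hN]
  have hk : ∀ k, (μ.prod P) (adjoin μ ⁻¹' N ∩ spanningSets μ k ×ˢ Set.univ) = 0 := fun k => by
    have h := hP.map_adjoin_eq_withDensity (measurableSet_spanningSets μ k)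
      (measure_spanningSets_lt_top μ k).ne
    rw [← Measure.restrict_apply (measurable_adjoin μ hN), ← Measure.restrict_prod_eq_prod_univ,
      ← Measure.map_apply (measurable_adjoin μ) hN, h]
    exact withDensity_absolutelyContinuous P _ h0
  refine measure_mono_null (fun p hp => ?_) (measure_iUnion_null hk)
  have : p.1 ∈ ⋃ k, spanningSets μ k := by simp [iUnion_spanningSets]
  obtain ⟨k, hk⟩ := Set.mem_iUnion.1 this
  exact Set.mem_iUnion.2 ⟨k, hp, hk, trivial⟩

/-- A property of the typical added point holds at every point of the process. -/
theorem ae_forall_mem_points (hP : IsPoissonProcess μ P) {Z : Set (X × CountableConfig X)}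
    (hZ : MeasurableSet Z) (h : ∀ᵐ p ∂μ.prod P, (p.1, adjoin μ p) ∈ Z) :
    ∀ᵐ ω ∂P, ∀ x ∈ ω.points, (x, ω) ∈ Z := by
  have := hP.isProbabilityMeasure
  have hk : ∀ k, ∀ᵐ ω ∂P, ∀ x ∈ ω.points ∩ spanningSets μ k, (x, ω) ∈ Z := by
    intro k
    have hB := measurableSet_spanningSets μ k
    have h1 : ∀ᵐ p ∂(μ.restrict (spanningSets μ k)).prod P, (p.1, adjoin μ p) ∈ Z := by
      rw [Measure.restrict_prod_eq_prod_univ]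
      exact ae_restrict_of_ae h
    have h2 : ∀ᵐ q ∂P ⊗ₘ pointKernel hB, q.swap ∈ Z := by
      refine ae_of_ae_map measurable_swap.aemeasurable (p := (· ∈ Z)) ?_
      rw [← hP.map_adjoin_eq_map_compProd hB (measure_spanningSets_lt_top μ k).ne]
      exact (ae_map_iff (measurable_fst.prodMk (measurable_adjoin μ)).aemeasurable hZ).2 h1
    filter_upwards [Measure.ae_ae_of_ae_compProd h2, hP.ae_mem_locallyFinite] with ω hω hfin
    have hs : MeasurableSet (ω.points ∩ spanningSets μ k) :=
      (ω.2.mono Set.inter_subset_left).measurableSet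
    -- For counting measure, almost everywhere means everywhere.
    rw [pointKernel_apply hB (hfin k), ae_restrict_iff' hs, Measure.ae_count_iff] at hω
    exact hω
  filter_upwards [ae_all_iff.2 hk] with ω hω x hx
  have : x ∈ ⋃ k, spanningSets μ k := by simp [iUnion_spanningSets]
  obtain ⟨k, hk⟩ := Set.mem_iUnion.1 this
  exact hω k x ⟨hx, hk⟩

/-- If the product action is ergodic, every equivariant thinning of a Poisson process is trivial. -/
theorem isTrivialThinning_of_ergodicSMul {G : Type*} [Group G] [MulAction G X]
    [MeasurableConstSMul G X] (hP : IsPoissonProcess μ P)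
    (hErg : ErgodicSMul G (X × CountableConfig X) (μ.prod P))
    {Ψ : CountableConfig X → CountableConfig X} (hΨ : IsEquivariantThinning G P Ψ) :
    IsTrivialThinning P Ψ := by
  have hsub := hP.ae_thinning_subset hΨ.1
  have hlf := hP.ae_mem_locallyFinite
  have hq := hP.quasiMeasurePreserving_adjoin
  have := hP.isProbabilityMeasure
  have hR : MeasurableSet {p : X × CountableConfig X | (p.1, Ψ p.2) ∈ incidence μ} :=
    (measurable_fst.prodMk (hΨ.1.measurable.comp measurable_snd)) (measurableSet_incidence μ)
  let S : Set (X × CountableConfig X) := {p | (p.1, Ψ (adjoin μ p)) ∈ incidence μ}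
  have hS : MeasurableSet S :=
    (measurable_fst.prodMk (measurable_adjoin μ)) hR
  have hSmem : ∀ᵐ p ∂μ.prod P, p ∈ S ↔ p.1 ∈ (Ψ (insertPoint p.1 p.2)).points := by
    filter_upwards [hq.ae hsub, hq.ae hlf, Measure.quasiMeasurePreserving_snd.ae hlf]
      with p h1 h2 h3
    rw [← adjoin_of_mem h3]
    -- The local finiteness built into `incidence` is automatic here, as the thinned configuration
    -- lies inside a locally finite one.
    exact and_iff_left (locallyFinite_mono h1 h2)
  have hinv : ∀ g : G, (g • ·) ⁻¹' S =ᵐ[μ.prod P] S := by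
    intro g
    have hg : Measure.QuasiMeasurePreserving (fun p : X × CountableConfig X => g • p)
        (μ.prod P) (μ.prod P) := by
      have hm : Measurable fun p : X × CountableConfig X => g • p :=
        (measurable_fst.const_smul g).prodMk (measurable_snd.const_smul g)
      refine ⟨hm, Measure.AbsolutelyContinuous.mk fun N hN h0 => ?_⟩
      rw [Measure.map_apply hm hN, SMulInvariantMeasure.measure_preimage_smul g hN, h0]
    -- Equivariance is needed at ω ∪ {x}, where it holds almost surely because `adjoin μ` is
    -- quasi-measure-preserving.
    filter_upwards [hSmem, hg.ae hSmem, hq.ae (hΨ.2 g),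
      Measure.quasiMeasurePreserving_snd.ae hlf] with p h1 h2 h3 h4
    rw [adjoin_of_mem h4] at h3
    refine propext ?_
    change g • p ∈ S ↔ p ∈ S
    rw [h1, h2, Prod.smul_fst, Prod.smul_snd, ← smul_insertPoint, h3, mem_points_smul]
  -- `S` conull: every point is kept. `S` null: none is.
  rcases Filter.eventuallyConst_set.1
    (hErg.aeconst_of_forall_preimage_smul_ae_eq hS hinv) with h | h
  · right
    filter_upwards [hP.ae_forall_mem_points hR h, hsub] with ω h1 h2
    exact ext_points (h2.antisymm fun x hx => (h1 x hx).1)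
  · left
    filter_upwards [hP.ae_forall_mem_points hR.compl h, hsub, hlf] with ω h1 h2 h3
    refine ext_points (Set.eq_empty_of_forall_notMem fun x hx => ?_)
    exact h1 x (h2 hx) ⟨hx, locallyFinite_mono h2 h3⟩

end IsPoissonProcess

theorem mainTheorem4 {X G : Type*} [MeasurableSpace X] [StandardBorelSpace X]
    (μ : Measure X) [SigmaFinite μ] [NullSingletonClass μ]
    [Group G] [MulAction G X] [MeasurableConstSMul G X] [SMulInvariantMeasure G X μ]
    (P : Measure (CountableConfig X)) (hP : IsPoissonProcess μ P)
    (hErg : ErgodicSMul G (X × CountableConfig X) (μ.prod P))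
    (Ψ : CountableConfig X → CountableConfig X) (hΨ : IsEquivariantThinning G P Ψ) :
    IsTrivialThinning P Ψ := by
  exact hP.isTrivialThinning_of_ergodicSMul hErg hΨ
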